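/- Let $L$ be a stable Lie ring or a stable Lie algebra (over a field, or more generally over a commutative ring $R$; Lie rings are the case $R=\mathbb Z$). This means that the underlying Lie ring of $L$ is interpretable, with parameters, in some first-order structure $M$ whose complete theory is stable, i.e. no formula has the order property; for instance $M$ may be $L$ itself in the language of Lie rings or in a richer language, or the two-sorted structure consisting of $L$ and its field of scalars. "Definable" means definable with parameters in $M$. A subalgebra $H$ of $L$ (subring, if $L$ is a Lie ring) is called a subideal of $L$ if there is a finite chain of subalgebras $H=H_0\lhd H_1\lhd\dots\lhd H_n=L$, each an ideal of the next. Let $N$ be an ideal of $L$. If $N$ is nilpotent (as a Lie algebra), then $N$ is contained in a definable nilpotent subideal of $L$. If $N$ is solvable, then $N$ is contained in a definable solvable subideal of $L$. -/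

import Mathlib

universe u v w x y

/-- The formula `φ(p; q)` has the order property in (the theory of) the structure `M`: there are
arbitrarily long finite sequences of tuples `a i`, `b j` with `φ(a i; b j)` true exactly when
`i < j`. The existence of such sequences of a given length is a first-order sentence, so this only
depends on the theory of `M`, and by compactness it says that some model of that theory
contains infinite sequences of this kind. -/
def FirstOrder.Language.Formula.HasOrderProperty {𝓛 : FirstOrder.Language.{u, v}} {m n : ℕ}
    (φ : 𝓛.Formula (Fin m ⊕ Fin n)) (M : Type w) [𝓛.Structure M] : Prop :=
  ∀ k : ℕ, ∃ (a : Fin k → Fin m → M) (b : Fin k → Fin n → M),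
    ∀ i j : Fin k, φ.Realize (Sum.elim (a i) (b j)) ↔ i < j

/-- The structure `M` (that is, its complete theory) is stable: no formula has the order
property. -/
def FirstOrder.Language.IsStableStructure (𝓛 : FirstOrder.Language.{u, v}) (M : Type w) [𝓛.Structure M] :
    Prop :=
  ∀ (m n : ℕ) (φ : 𝓛.Formula (Fin m ⊕ Fin n)), ¬ φ.HasOrderProperty M

/-- A coordinatization of the set `L` in `M`: a surjection `π` onto `L` from a set `D` of tuples of
`M` of a fixed finite length. So `L` is `D` modulo the equivalence relation `π p = π q`. -/
structure Coordinatization (M : Type w) (L : Type x) where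
  /-- the length of the tuples -/
  dim : ℕ
  /-- the set of tuples that represent an element of `L` -/
  D : Set (Fin dim → M)
  /-- the element that a tuple represents -/
  π : D → L
  surjective : Function.Surjective π

namespace Coordinatization

variable {M : Type w} {L : Type x}

/-- The set of all tuples of `M` that represent an element of `S ⊆ L ^ k`. -/
def pullback (c : Coordinatization M L) {k : ℕ} (S : Set (Fin k → L)) :
    Set (Fin k × Fin c.dim → M) :=
  {t | ∃ l ∈ S, ∀ i, ∃ h : (fun j => t (i, j)) ∈ c.D, c.π ⟨fun j => t (i, j), h⟩ = l i}

/-- `S ⊆ L ^ k` is definable, with parameters, in the structure `M`. -/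
def DefinableRel (c : Coordinatization M L) (𝓛 : FirstOrder.Language.{u, v}) [𝓛.Structure M] {k : ℕ}
    (S : Set (Fin k → L)) : Prop :=
  (Set.univ : Set M).Definable 𝓛 (c.pullback S)

/-- `S ⊆ L` is definable, with parameters, in the structure `M`. -/
def DefinableSubset (c : Coordinatization M L) (𝓛 : FirstOrder.Language.{u, v}) [𝓛.Structure M]
    (S : Set L) : Prop :=
  c.DefinableRel 𝓛 {l : Fin 1 → L | l 0 ∈ S}

/-- The coordinatization is an interpretation (with parameters) of the Lie ring `L` in the
structure `M`: the set of representing tuples, equality, addition and bracket are definable. -/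
structure InterpretsLieRing (c : Coordinatization M L) (𝓛 : FirstOrder.Language.{u, v}) [𝓛.Structure M]
    [LieRing L] : Prop where
  domain : c.DefinableSubset 𝓛 Set.univ
  eq : c.DefinableRel 𝓛 {l : Fin 2 → L | l 0 = l 1}
  add : c.DefinableRel 𝓛 {l : Fin 3 → L | l 0 + l 1 = l 2}
  bracket : c.DefinableRel 𝓛 {l : Fin 3 → L | ⁅l 0, l 1⁆ = l 2}

end Coordinatization

/-- `H` is a subideal of `L`: there is a finite chain of subalgebras
`H = H₀ ⊲ H₁ ⊲ ⋯ ⊲ Hₙ = L`, each an ideal of the next one. -/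
def LieSubalgebra.IsSubideal {R : Type y} {L : Type x} [CommRing R] [LieRing L] [LieAlgebra R L]
    (H : LieSubalgebra R L) : Prop :=
  ∃ (n : ℕ) (C : ℕ → LieSubalgebra R L), C 0 = H ∧ C n = ⊤ ∧
    ∀ i < n, C i ≤ C (i + 1) ∧ ∀ a ∈ C (i + 1), ∀ b ∈ C i, ⁅a, b⁆ ∈ C i

/-! For a definable subalgebra `B`, the sets `{x | ⁅x, a⁆ ∈ B}` are uniformly definable additive
subgroups. By stability and the Baldwin–Saxl argument (`exists_finset_forall_mem_of_orderBounded`),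
every intersection of them is a finite one. Centralizers modulo `B` of arbitrary sets are therefore
definable (`definableSubset_relCentralizer`). The rest is algebra: `N` is enclosed using such
centralizers only, by taking double centralizers. In the nilpotent case these follow the upper
central series of `N` while the ambient subideal shrinks; in the solvable case they follow the
derived series of `N` from the bottom up, inside `L`, and even yield an ideal. -/

/-! ### Order-boundedness and stability -/

/-- A relation is order-bounded if for some `k` there are no sequences of length `k` on which it
is the strict order of the indices. -/
def OrderBounded {X : Type*} {Y : Type*} (r : X → Y → Prop) : Prop :=
  ∃ k : ℕ, ∀ (a : Fin k → X) (b : Fin k → Y), ¬ ∀ i j, r (a i) (b j) ↔ i < j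

theorem OrderBounded.of_comp {X Y X' Y' : Type*} {r : X → Y → Prop} {r' : X' → Y' → Prop}
    (h : OrderBounded r) (f : X' → X) (g : Y' → Y) (hfg : ∀ x y, r (f x) (g y) ↔ r' x y) :
    OrderBounded r' := by
  obtain ⟨k, hk⟩ := h
  exact ⟨k, fun a b hab => hk (f ∘ a) (g ∘ b) fun i j => (hfg _ _).trans (hab i j)⟩

/-- The finitely many parameters of the defining formula become extra variables of the second tuple,
with values independent of `j`. -/
theorem FirstOrder.Language.IsStableStructure.orderBounded {𝓛 : FirstOrder.Language.{u, v}}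
    {M : Type w} [𝓛.Structure M] (hM : 𝓛.IsStableStructure M) {α β : Type*} [Finite α] [Finite β]
    {A : Set M} {T : Set (α ⊕ β → M)} (hT : A.Definable 𝓛 T) :
    OrderBounded fun (s : α → M) (t : β → M) => Sum.elim s t ∈ T := by
  classical
  obtain ⟨φ, rfl⟩ := Set.definable_iff_exists_formula_sum.1 hT
  obtain ⟨m, ⟨eα⟩⟩ := Finite.exists_equiv_fin α
  obtain ⟨n, ⟨eβ⟩⟩ := Finite.exists_equiv_fin (β ⊕ φ.freeVarFinset.toLeft)
  let ψ : 𝓛.Formula (Fin m ⊕ Fin n) := φ.restrictFreeVar fun z =>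
    Sum.casesOn (motive := fun z => z ∈ φ.freeVarFinset → Fin m ⊕ Fin n) z.1
      (fun p hp => Sum.inr (eβ (Sum.inr ⟨p, by simpa using hp⟩)))
      (fun q _ => Sum.elim (fun a => Sum.inl (eα a)) (fun b => Sum.inr (eβ (Sum.inl b))) q) z.2
  by_contra hcon
  refine hM m n ψ fun k => ?_
  have hk : ∃ (a : Fin k → α → M) (b : Fin k → β → M), ∀ i j,
      Sum.elim (a i) (b j) ∈ {v : α ⊕ β → M | φ.Realize (Sum.elim (↑) v)} ↔ i < j := by
    by_contra h
    exact hcon ⟨k, fun a b hab => h ⟨a, b, hab⟩⟩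
  obtain ⟨a, b, hab⟩ := hk
  refine ⟨fun i => a i ∘ eα.symm,
    fun j => Sum.elim (b j) (fun p : φ.freeVarFinset.toLeft => (p.1 : M)) ∘ eβ.symm,
    fun i j => Iff.trans ?_ (hab i j)⟩
  refine FirstOrder.Language.BoundedFormula.realize_restrictFreeVar
    (Sum.elim Subtype.val (Sum.elim (a i) (b j))) ?_
  rintro ⟨p | q | q, hz⟩ <;> simp

/-- Baldwin–Saxl. The case `n = 1` bounds the size of irredundant finite intersections by some `k`;
the case `n = k` then excludes an infinite descending chain of finite intersections. -/
theorem exists_finset_forall_mem_of_orderBounded {G ι : Type*} [AddCommGroup G]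
    (C : ι → AddSubgroup G)
    (hC : ∀ n, OrderBounded fun (x : G) (a : Fin n → ι) => ∀ i, x ∈ C (a i)) (A : Set ι) :
    ∃ s : Finset ι, ↑s ⊆ A ∧ ∀ x, (∀ a ∈ s, x ∈ C a) → ∀ a ∈ A, x ∈ C a := by
  classical
  obtain ⟨k, hk⟩ := hC 1
  have key : ∀ s : Finset ι, s.Nonempty →
      ∃ f : Fin k → ι, ∀ x, (∀ i, x ∈ C (f i)) ↔ ∀ a ∈ s, x ∈ C a := by
    rintro s ⟨a₀, ha₀⟩
    obtain ⟨t, ⟨hts, ht⟩, hmin⟩ := wellFounded_lt.has_min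
      {t : Finset ι | t ⊆ s ∧ ∀ x, (∀ a ∈ t, x ∈ C a) → ∀ a ∈ s, x ∈ C a}
      ⟨s, subset_rfl, fun _ h => h⟩
    have hx : ∀ b : t, ∃ x, (∀ a ∈ t, a ≠ b → x ∈ C a) ∧ x ∉ C b := by
      rintro ⟨b, hb⟩
      by_contra! h
      refine hmin (t.erase b) ⟨(t.erase_subset b).trans hts, fun x hx => ht x fun a ha => ?_⟩
        (Finset.erase_ssubset hb)
      have hxb : ∀ a ∈ t, a ≠ b → x ∈ C a := fun a ha hab => hx a (Finset.mem_erase.2 ⟨hab, ha⟩)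
      by_cases hab : a = b
      · exact hab ▸ h x hxb
      · exact hxb a ha hab
    choose x hx hx' using hx
    have hcard : t.card < k := by
      by_contra! hle
      obtain ⟨e⟩ : Nonempty (Fin k ↪ t) :=
        Function.Embedding.nonempty_of_card_le (by simpa using hle)
      -- The only summand that can lie outside `C (e j)` is `x (e j)`, so the partial sum up to `i`
      -- lies in it exactly when `i < j`.
      refine hk (fun i => ∑ l ∈ Finset.Iic i, x (e l)) (fun j _ => e j) fun i j => ?_
      have hmem : ∀ l, l ≠ j → x (e l) ∈ C (e j) := fun l hl =>
        hx (e l) _ (e j).2 fun h => hl (e.injective (Subtype.ext h)).symm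
      simp only [forall_const]
      refine ⟨fun h => ?_, fun h => ?_⟩
      · by_contra! hji
        rw [← Finset.add_sum_erase _ _ (Finset.mem_Iic.2 hji)] at h
        refine hx' (e j) ((AddSubgroup.add_mem_cancel_right _ ?_).1 h)
        exact AddSubgroup.sum_mem _ fun l hl => hmem l (Finset.mem_erase.1 hl).1
      · exact AddSubgroup.sum_mem _ fun l hl => hmem l ((Finset.mem_Iic.1 hl).trans_lt h).ne
    -- Adding `a₀` covers the case `t = ∅`; `t.card < k` leaves room for it.
    obtain ⟨e⟩ : Nonempty ((insert a₀ t : Finset ι) ↪ Fin k) := by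
      refine Function.Embedding.nonempty_of_card_le ?_
      simpa using (Finset.card_insert_le a₀ t).trans hcard
    have : Nonempty (insert a₀ t : Finset ι) := ⟨⟨a₀, by simp⟩⟩
    refine ⟨fun i => (Function.invFun e i : (insert a₀ t : Finset ι)), fun x =>
      ⟨fun h => ht x fun a ha => ?_, fun h i => h _ ?_⟩⟩
    · obtain ⟨i, hi⟩ := Function.invFun_surjective e.injective ⟨a, Finset.mem_insert_of_mem ha⟩
      simpa [hi] using h i
    · exact Finset.insert_subset ha₀ hts (Function.invFun e i).2
  by_contra! hcon
  have hcon' : ∀ s : Finset ι, ∃ x a, ↑s ⊆ A → (∀ a ∈ s, x ∈ C a) ∧ a ∈ A ∧ x ∉ C a := by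
    intro s
    by_cases hs : ↑s ⊆ A
    · obtain ⟨x, hx, a, ha, hxa⟩ := hcon s hs
      exact ⟨x, a, fun _ => ⟨hx, ha, hxa⟩⟩
    · obtain ⟨-, -, a, -⟩ := hcon ∅ (by simp)
      exact ⟨0, a, fun h => absurd h hs⟩
  choose x a hxa using hcon'
  let S : ℕ → Finset ι := fun n => (fun s => insert (a s) s)^[n] {a ∅}
  have hS : ∀ n, S (n + 1) = insert (a (S n)) (S n) := fun n => Function.iterate_succ_apply' _ n _
  have hSA : ∀ n, (S n : Set ι) ⊆ A := by
    intro n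
    induction n with
    | zero => simpa [S] using (hxa ∅ (by simp)).2.1
    | succ n ih =>
      rw [hS, Finset.coe_insert]
      exact Set.insert_subset (hxa _ ih).2.1 ih
  have hmono : Monotone S := monotone_nat_of_le_succ fun n => by
    rw [hS]
    exact Finset.subset_insert _ _
  have hne : ∀ n, (S n).Nonempty := fun n =>
    ⟨a ∅, hmono (Nat.zero_le n) (by simp [S])⟩
  choose f hf using fun n => key (S n) (hne n)
  obtain ⟨m, hm⟩ := hC k
  -- `x (S m)` lies in the intersection over `S (l + 1)` exactly when `l < m`; `Fin.rev` turns this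
  -- order around.
  refine hm (fun i => x (S i.rev)) (fun j => f (j.rev + 1)) fun i j => ?_
  beta_reduce
  rw [hf, ← Fin.rev_lt_rev]
  refine ⟨fun h => ?_, fun h b hb => (hxa _ (hSA _)).1 b (hmono (Nat.succ_le_of_lt h) hb)⟩
  by_contra! hle
  refine (hxa _ (hSA (i.rev : ℕ))).2.2 (h _ (hmono (Nat.succ_le_succ hle) ?_))
  rw [Nat.succ_eq_add_one, hS]
  exact Finset.mem_insert_self _ _

/-! ### Nilpotency by iterated brackets -/

/-- The elements of `L` that any `k` successive brackets with elements of `S` send to `0`. -/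
def iteratedCentralizer {L : Type*} [LieRing L] (S : Set L) : ℕ → Set L
  | 0 => {0}
  | k + 1 => {x | ∀ y ∈ S, ⁅y, x⁆ ∈ iteratedCentralizer S k}

theorem iteratedCentralizer_antitone {L : Type*} [LieRing L] {S S' : Set L} (h : S ⊆ S') (k : ℕ) :
    iteratedCentralizer S' k ⊆ iteratedCentralizer S k := by
  induction k with
  | zero => exact subset_rfl
  | succ k ih => exact fun x hx y hy => ih (hx y (h hy))

theorem LieSubalgebra.isNilpotent_iff_exists_subset_iteratedCentralizer {R L : Type*} [CommRing R]
    [LieRing L] [LieAlgebra R L] (K : LieSubalgebra R L) :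
    LieRing.IsNilpotent K ↔ ∃ k, (K : Set L) ⊆ iteratedCentralizer (K : Set L) k := by
  have key : ∀ k (x : K),
      x ∈ (⊥ : LieSubmodule R K K).ucs k ↔ (x : L) ∈ iteratedCentralizer (K : Set L) k := by
    intro k
    induction k with
    | zero => intro x; simp [iteratedCentralizer]
    | succ k ih =>
      intro x
      rw [LieSubmodule.ucs_succ, LieSubmodule.mem_normalizer]
      simp only [ih]
      exact ⟨fun h y hy => h ⟨y, hy⟩, fun h y => h y y.2⟩
  rw [LieRing.IsNilpotent, LieModule.isNilpotent_iff_exists_ucs_eq_top R]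
  refine exists_congr fun k => ?_
  rw [eq_top_iff]
  exact ⟨fun h x hx => (key k ⟨x, hx⟩).1 (h (LieSubmodule.mem_top _)),
    fun h x _ => (key k x).2 (h x.2)⟩

/-! ### Relative centralizers and the two enclosing constructions -/

namespace LieSubalgebra

variable {R : Type*} {L : Type*} [CommRing R] [LieRing L] [LieAlgebra R L]

/-- The elements of `K` whose brackets with the elements of `A` lie in `B`, where `B` is normalized
by `K`. -/
def relCentralizer (K B : LieSubalgebra R L) (hB : ∀ y ∈ K, ∀ b ∈ B, ⁅y, b⁆ ∈ B) (A : Set L) :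
    LieSubalgebra R L where
  carrier := {x | x ∈ K ∧ ∀ a ∈ A, ⁅x, a⁆ ∈ B}
  zero_mem' := ⟨K.zero_mem, fun a _ => by simp⟩
  add_mem' := fun {x y} hx hy => ⟨K.add_mem hx.1 hy.1, fun a ha => by
    rw [add_lie]
    exact B.add_mem (hx.2 a ha) (hy.2 a ha)⟩
  smul_mem' := fun r x hx => ⟨K.smul_mem r hx.1, fun a ha => by
    rw [smul_lie]
    exact B.smul_mem r (hx.2 a ha)⟩
  lie_mem' := fun {x y} hx hy => ⟨K.lie_mem hx.1 hy.1, fun a ha => by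
    rw [lie_lie]
    exact B.sub_mem (hB _ hx.1 _ (hy.2 a ha)) (hB _ hy.1 _ (hx.2 a ha))⟩

/-- The relative centralizer of a set that is normalized by `K` is normalized by `K`. -/
theorem lie_mem_relCentralizer {K B : LieSubalgebra R L} {hB : ∀ y ∈ K, ∀ b ∈ B, ⁅y, b⁆ ∈ B}
    {A : Set L} (hA : ∀ y ∈ K, ∀ a ∈ A, ⁅y, a⁆ ∈ A) {y x : L} (hy : y ∈ K)
    (hx : x ∈ K.relCentralizer B hB A) : ⁅y, x⁆ ∈ K.relCentralizer B hB A := by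
  refine ⟨K.lie_mem hy hx.1, fun a ha => ?_⟩
  rw [lie_lie]
  exact B.sub_mem (hB _ hy _ (hx.2 a ha)) (hx.2 _ (hA y hy a ha))

theorem isSubideal_top : (⊤ : LieSubalgebra R L).IsSubideal :=
  ⟨0, fun _ => ⊤, rfl, rfl, by simp⟩

theorem IsSubideal.of_le {H K : LieSubalgebra R L} (hK : K.IsSubideal) (hHK : H ≤ K)
    (h : ∀ a ∈ K, ∀ b ∈ H, ⁅a, b⁆ ∈ H) : H.IsSubideal := by
  obtain ⟨n, C, hC₀, hCn, hC⟩ := hK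
  refine ⟨n + 1, fun i => Nat.casesOn i H C, rfl, hCn, fun i hi => ?_⟩
  cases i with
  | zero => subst hC₀; exact ⟨hHK, h⟩
  | succ i => exact hC i (by omega)

/-- If `P` holds of `0` and `L` and passes to relative centralizers, then every nilpotent ideal is
contained in a nilpotent subideal that satisfies `P`. -/
theorem exists_nilpotent_subideal (P : Set L → Prop) (hbot : P {0}) (htop : P Set.univ)
    (hP : ∀ (K B : LieSubalgebra R L) (hB : ∀ y ∈ K, ∀ b ∈ B, ⁅y, b⁆ ∈ B) (A : Set L),
      P K → P B → P (K.relCentralizer B hB A))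
    (N : LieIdeal R L) (hN : LieRing.IsNilpotent N) :
    ∃ H : LieSubalgebra R L, (N : Set L) ⊆ H ∧ H.IsSubideal ∧ P H ∧ LieRing.IsNilpotent H := by
  -- `B` stands for the `k`-th upper central term: `k` brackets with `K` kill it, and it contains
  -- that term of `N`.
  have key : ∀ k, ∃ K B : LieSubalgebra R L, P K ∧ P B ∧ K.IsSubideal ∧ (N : Set L) ⊆ K ∧
      B ≤ K ∧ (∀ y ∈ K, ∀ b ∈ B, ⁅y, b⁆ ∈ B) ∧ (B : Set L) ⊆ iteratedCentralizer K k ∧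
      ∀ x ∈ N, x ∈ iteratedCentralizer (N : Set L) k → x ∈ B := by
    intro k
    induction k with
    | zero =>
      refine ⟨⊤, ⊥, by simpa using htop, by simpa using hbot, isSubideal_top,
        fun _ _ => LieSubalgebra.mem_top _, bot_le, ?_, ?_, ?_⟩
      · rintro y - b hb
        rw [LieSubalgebra.mem_bot] at hb ⊢
        rw [hb, lie_zero]
      · intro b hb
        exact (LieSubalgebra.mem_bot b).1 hb
      · intro x _ hx
        exact (LieSubalgebra.mem_bot x).2 hx
    | succ k ih =>
      obtain ⟨K, B, hPK, hPB, hK, hNK, hBK, hB, hBk, hNB⟩ := ih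
      -- `A` is the part of `N` that is central modulo `B`. Its centralizer `K'` modulo `B` contains
      -- `N`, and `B'`, the centre of `K'` modulo `B`, contains `A`.
      let A : Set L := {x | x ∈ N ∧ ∀ n ∈ N, ⁅n, x⁆ ∈ B}
      have hA : ∀ y ∈ K, ∀ a ∈ A, ⁅y, a⁆ ∈ A := by
        rintro y hy a ⟨ha, ha'⟩
        refine ⟨lie_mem_right R L N y a ha, fun n hn => ?_⟩
        rw [leibniz_lie]
        exact B.add_mem (ha' _ (lie_mem_left R L N n y hn)) (hB y hy _ (ha' n hn))
      let K' := K.relCentralizer B hB A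
      have hKK' : K' ≤ K := fun x hx => hx.1
      have hBK' : B ≤ K' := fun b hb => ⟨hBK hb, fun a ha => by
        rw [← lie_skew]
        exact B.neg_mem (hB a (hNK ha.1) b hb)⟩
      have hB' : ∀ y ∈ K', ∀ b ∈ B, ⁅y, b⁆ ∈ B := fun y hy => hB y (hKK' hy)
      have hNK' : (N : Set L) ⊆ K' := fun n hn => ⟨hNK hn, fun a ha => ha.2 n hn⟩
      let B' := K'.relCentralizer B hB' (K' : Set L)
      have hmem : ∀ y ∈ K', ∀ b ∈ B', ⁅y, b⁆ ∈ B := fun y hy b hb => by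
        rw [← lie_skew]
        exact B.neg_mem (hb.2 y hy)
      refine ⟨K', B', hP _ _ _ _ hPK hPB, hP _ _ _ _ (hP _ _ _ _ hPK hPB) hPB,
        hK.of_le hKK' fun a ha b hb => lie_mem_relCentralizer hA ha hb, hNK',
        fun b hb => hb.1, fun y hy b hb => ⟨K'.lie_mem hy hb.1, fun a ha => ?_⟩, ?_, ?_⟩
      · rw [← lie_skew]
        exact B.neg_mem (hB' a ha _ (hmem y hy b hb))
      · exact fun b hb y hy => iteratedCentralizer_antitone hKK' k (hBk (hmem y hy b hb))
      · intro x hxN hx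
        have hxA : x ∈ A := ⟨hxN, fun n hn => hNB _ (lie_mem_right R L N n x hxN) (hx n hn)⟩
        refine ⟨hNK' hxN, fun y hy => ?_⟩
        rw [← lie_skew]
        exact B.neg_mem (hy.2 x hxA)
  obtain ⟨k, hk⟩ := (isNilpotent_iff_exists_subset_iteratedCentralizer
    (N : LieSubalgebra R L)).1 hN
  obtain ⟨K, B, -, hPB, hK, -, hBK, hB, hBk, hNB⟩ := key k
  exact ⟨B, fun x hx => hNB x hx (hk hx), hK.of_le hBK hB, hPB,
    (isNilpotent_iff_exists_subset_iteratedCentralizer B).2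
      ⟨k, hBk.trans (iteratedCentralizer_antitone hBK k)⟩⟩

/-- If `P` holds of `0` and `L` and passes to relative centralizers, then every solvable ideal is
contained in a solvable subideal that satisfies `P`. -/
theorem exists_solvable_subideal (P : Set L → Prop) (hbot : P {0}) (htop : P Set.univ)
    (hP : ∀ (K B : LieSubalgebra R L) (hB : ∀ y ∈ K, ∀ b ∈ B, ⁅y, b⁆ ∈ B) (A : Set L),
      P K → P B → P (K.relCentralizer B hB A))
    (N : LieIdeal R L) (hN : LieAlgebra.IsSolvable N) :
    ∃ H : LieSubalgebra R L, (N : Set L) ⊆ H ∧ H.IsSubideal ∧ P H ∧ LieAlgebra.IsSolvable H := by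
  obtain ⟨n, hn⟩ := LieAlgebra.IsSolvable.solvable R N
  rw [LieIdeal.derivedSeries_eq_bot_iff] at hn
  have key : ∀ k ≤ n, ∃ I : LieIdeal R L, P (I : Set L) ∧
      LieAlgebra.derivedSeriesOfIdeal R L (n - k) N ≤ I ∧
      LieAlgebra.derivedSeriesOfIdeal R L k I = ⊥ := by
    intro k
    induction k with
    | zero => exact fun _ => ⟨⊥, by simpa using hbot, hn.le, rfl⟩
    | succ k ih =>
      intro hk
      obtain ⟨I, hPI, hNI, hI⟩ := ih (by omega)
      set J := LieAlgebra.derivedSeriesOfIdeal R L (n - (k + 1)) N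
      have hJI : ∀ a ∈ J, ∀ b ∈ J, ⁅a, b⁆ ∈ I := fun a ha b hb => hNI <| by
        rw [show n - k = n - (k + 1) + 1 by omega, LieAlgebra.derivedSeriesOfIdeal_succ]
        exact LieSubmodule.lie_mem_lie ha hb
      let B : LieSubalgebra R L := I
      have hB : ∀ y ∈ (⊤ : LieSubalgebra R L), ∀ b ∈ B, ⁅y, b⁆ ∈ B :=
        fun y _ b hb => lie_mem_right R L I y b hb
      -- `J` is abelian modulo `I`, so `J ⊆ C`. Hence `E`, which centralizes `C` modulo `I`, also
      -- centralizes `J`; thus `E ⊆ C` and `E` is abelian modulo `I`.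
      let C := (⊤ : LieSubalgebra R L).relCentralizer B hB (J : Set L)
      let E := (⊤ : LieSubalgebra R L).relCentralizer B hB (C : Set L)
      have hC : ∀ y ∈ (⊤ : LieSubalgebra R L), ∀ c ∈ C, ⁅y, c⁆ ∈ C := fun y hy c hc =>
        lie_mem_relCentralizer (fun y _ a ha => lie_mem_right R L J y a ha) hy hc
      have hJC : ∀ a ∈ J, a ∈ C := fun a ha => ⟨LieSubalgebra.mem_top a, hJI a ha⟩
      let I' : LieIdeal R L :=
        { E.toSubmodule with
          lie_mem := fun {y x} hx => lie_mem_relCentralizer hC (LieSubalgebra.mem_top y) hx }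
      have hPtop : P ((⊤ : LieSubalgebra R L) : Set L) := by simpa using htop
      have hJE : ∀ a ∈ J, a ∈ I' := fun a ha => ⟨LieSubalgebra.mem_top a, fun c hc => by
        rw [← lie_skew]
        exact B.neg_mem (hc.2 a ha)⟩
      refine ⟨I', hP _ _ hB _ hPtop hPI, hJE, ?_⟩
      rw [LieAlgebra.derivedSeriesOfIdeal_add, ← le_bot_iff, ← hI]
      refine LieAlgebra.derivedSeriesOfIdeal_mono ?_ k
      rw [LieAlgebra.derivedSeriesOfIdeal_succ, LieAlgebra.derivedSeriesOfIdeal_zero,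
        LieSubmodule.lieIdeal_oper_eq_span, LieSubmodule.lieSpan_le]
      rintro _ ⟨⟨a, ha⟩, ⟨b, hb⟩, rfl⟩
      exact ha.2 b ⟨LieSubalgebra.mem_top b, fun c hc => hb.2 c (hJC c hc)⟩
  obtain ⟨I, hPI, hNI, hI⟩ := key n le_rfl
  rw [Nat.sub_self, LieAlgebra.derivedSeriesOfIdeal_zero] at hNI
  exact ⟨I, hNI, isSubideal_top.of_le le_top fun a _ b hb => lie_mem_right R L I a b hb, hPI,
    LieAlgebra.IsSolvable.mk (R := R) ((LieIdeal.derivedSeries_eq_bot_iff I n).2 hI)⟩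

end LieSubalgebra

/-! ### Definability in the interpreted Lie ring -/

namespace Coordinatization

variable {M : Type w} {L : Type x}

/-- The tuple `p` represents the element `l`. -/
def Represents (c : Coordinatization M L) (p : Fin c.dim → M) (l : L) : Prop :=
  ∃ h : p ∈ c.D, c.π ⟨p, h⟩ = l

theorem Represents.eq {c : Coordinatization M L} {p : Fin c.dim → M} {l l' : L}
    (h : c.Represents p l) (h' : c.Represents p l') : l = l' := by
  obtain ⟨_, rfl⟩ := h
  obtain ⟨_, rfl⟩ := h'
  rfl

theorem exists_represents (c : Coordinatization M L) (l : L) : ∃ p, c.Represents p l := by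
  obtain ⟨p, hp⟩ := c.surjective l
  exact ⟨p, p.2, hp⟩

theorem mem_pullback {c : Coordinatization M L} {k : ℕ} {S : Set (Fin k → L)}
    {t : Fin k × Fin c.dim → M} :
    t ∈ c.pullback S ↔ ∃ l ∈ S, ∀ i, c.Represents (fun j => t (i, j)) (l i) :=
  Iff.rfl

variable {𝓛 : FirstOrder.Language.{u, v}} [𝓛.Structure M] {c : Coordinatization M L}

theorem definableSubset_iff {S : Set L} : c.DefinableSubset 𝓛 S ↔
    (Set.univ : Set M).Definable 𝓛 {p : Fin c.dim → M | ∃ l ∈ S, c.Represents p l} := by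
  refine ⟨fun h => ?_, fun h => ?_⟩
  · refine (congrArg _ ?_).mp (h.preimage_comp (β := Fin c.dim) fun ij => ij.2)
    ext p
    simp only [Set.mem_preimage, mem_pullback, Set.mem_ofPred_eq]
    exact ⟨fun ⟨l, hl, h⟩ => ⟨l 0, hl, h 0⟩, fun ⟨l, hl, h⟩ => ⟨fun _ => l, hl, fun _ => h⟩⟩
  · rw [DefinableSubset, DefinableRel]
    refine (congrArg _ ?_).mp (h.preimage_comp (β := Fin 1 × Fin c.dim) fun j => (0, j))
    ext t
    simp only [Set.mem_preimage, mem_pullback, Set.mem_ofPred_eq]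
    refine ⟨fun ⟨l, hl, h⟩ => ⟨fun _ => l, hl, fun i => ?_⟩, fun ⟨l, hl, h⟩ => ⟨l 0, hl, h 0⟩⟩
    rw [Subsingleton.elim i 0]
    exact h

theorem DefinableSubset.inter {S T : Set L} (hS : c.DefinableSubset 𝓛 S)
    (hT : c.DefinableSubset 𝓛 T) : c.DefinableSubset 𝓛 (S ∩ T) := by
  rw [definableSubset_iff] at *
  convert hS.inter hT using 1
  ext p
  refine ⟨fun ⟨l, hl, h⟩ => ⟨⟨l, hl.1, h⟩, ⟨l, hl.2, h⟩⟩, ?_⟩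
  rintro ⟨⟨l, hl, h⟩, ⟨l', hl', h'⟩⟩
  obtain rfl := h.eq h'
  exact ⟨l, ⟨hl, hl'⟩, h⟩

theorem DefinableSubset.biInter_finset {ι : Type*} (huniv : c.DefinableSubset 𝓛 Set.univ)
    (s : Finset ι) (S : ι → Set L) (hS : ∀ i ∈ s, c.DefinableSubset 𝓛 (S i)) :
    c.DefinableSubset 𝓛 {l | ∀ i ∈ s, l ∈ S i} := by
  classical
  induction s using Finset.induction_on with
  | empty => simpa using huniv
  | insert i s _ ih =>
    convert (hS i (Finset.mem_insert_self _ _)).inter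
      (ih fun j hj => hS j (Finset.mem_insert_of_mem hj)) using 1
    ext l
    simp

/-- A fibre of a definable relation is definable. -/
theorem definableSubset_fiber {r : L → L → Prop}
    (hr : (Set.univ : Set M).Definable 𝓛 {t : Fin c.dim ⊕ Fin c.dim → M |
      ∃ l a, c.Represents (t ∘ Sum.inl) l ∧ c.Represents (t ∘ Sum.inr) a ∧ r l a}) (a : L) :
    c.DefinableSubset 𝓛 {l | r l a} := by
  obtain ⟨p, hp⟩ := c.exists_represents a
  -- The coordinates of a representative of `a` serve as parameters.
  have hconst : (Set.univ : Set M).Definable 𝓛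
      (⋂ j, {t : Fin c.dim ⊕ Fin c.dim → M | t (Sum.inr j) = p j}) :=
    Set.definable_iInter_of_finite fun j =>
      (Set.Definable.singleton_of_mem 𝓛 (Set.mem_univ (p j))).preimage_comp
        (fun _ : Fin 1 => (Sum.inr j : Fin c.dim ⊕ Fin c.dim))
  rw [definableSubset_iff]
  convert (hr.inter hconst).image_comp Sum.inl using 1
  ext q
  constructor
  · rintro ⟨l, hl, hq⟩
    exact ⟨Sum.elim q p, ⟨⟨l, a, by simpa using hq, by simpa using hp, hl⟩, by simp⟩, by simp⟩
  · rintro ⟨t, ⟨⟨l, a', hl, ha', h⟩, ht⟩, rfl⟩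
    have htp : t ∘ Sum.inr = p := funext fun j => Set.mem_iInter.1 ht j
    obtain rfl := ha'.eq (htp ▸ hp)
    exact ⟨l, h, hl⟩

variable [LieRing L]

theorem InterpretsLieRing.definableSubset_zero (hc : c.InterpretsLieRing 𝓛) :
    c.DefinableSubset 𝓛 {0} := by
  refine definableSubset_fiber (r := fun l a => l = a) ?_ 0
  convert hc.eq.image_comp (Sum.elim (fun j => (0, j)) fun j => (1, j)) using 1
  ext t
  constructor
  · rintro ⟨l, a, hl, ha, h⟩
    refine ⟨fun ij => ![t ∘ Sum.inl, t ∘ Sum.inr] ij.1 ij.2, ⟨![l, a], h, ?_⟩, ?_⟩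
    · intro i
      fin_cases i
      · exact hl
      · exact ha
    · ext (j | j) <;> rfl
  · rintro ⟨t, ⟨l, hl, h⟩, rfl⟩
    exact ⟨l 0, l 1, h 0, h 1, hl⟩

theorem InterpretsLieRing.definable_lie_mem (hc : c.InterpretsLieRing 𝓛) {B : Set L}
    (hB : c.DefinableSubset 𝓛 B) :
    (Set.univ : Set M).Definable 𝓛 {t : Fin c.dim ⊕ Fin c.dim → M |
      ∃ l a, c.Represents (t ∘ Sum.inl) l ∧ c.Represents (t ∘ Sum.inr) a ∧ ⁅l, a⁆ ∈ B} := by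
  convert (hc.bracket.inter ((definableSubset_iff.1 hB).preimage_comp
    fun j => ((2, j) : Fin 3 × Fin c.dim))).image_comp
      (Sum.elim (fun j => (0, j)) fun j => (1, j)) using 1
  ext t
  constructor
  · rintro ⟨l, a, hl, ha, h⟩
    obtain ⟨p, hp⟩ := c.exists_represents ⁅l, a⁆
    refine ⟨fun ij => ![t ∘ Sum.inl, t ∘ Sum.inr, p] ij.1 ij.2,
      ⟨⟨![l, a, ⁅l, a⁆], rfl, ?_⟩, _, h, hp⟩, ?_⟩
    · intro i
      fin_cases i
      · exact hl
      · exact ha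
      · exact hp
    · ext (j | j) <;> rfl
  · rintro ⟨t, ⟨⟨l, hl, h⟩, b, hb, hb'⟩, rfl⟩
    refine ⟨l 0, l 1, h 0, h 1, ?_⟩
    rw [show ⁅l 0, l 1⁆ = l 2 from hl, Represents.eq (h 2) hb']
    exact hb

/-- Order-boundedness passes from `M` to `L` along a choice of representatives. Tuples of every
length `n` are needed, since Baldwin–Saxl compares intersections of several subgroups. -/
theorem InterpretsLieRing.orderBounded_lie_mem (hM : 𝓛.IsStableStructure M)
    (hc : c.InterpretsLieRing 𝓛) {B : Set L} (hB : c.DefinableSubset 𝓛 B) (n : ℕ) :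
    OrderBounded fun (l : L) (a : Fin n → L) => ∀ i, ⁅l, a i⁆ ∈ B := by
  have hT := Set.definable_iInter_of_finite fun i : Fin n =>
    (hc.definable_lie_mem hB).preimage_comp
      (β := Fin c.dim ⊕ Fin n × Fin c.dim) (Sum.map id fun j => (i, j))
  choose p hp using c.exists_represents
  refine (hM.orderBounded hT).of_comp p (fun a ij => p (a ij.1) ij.2) fun l a => ?_
  simp only [Set.mem_iInter]
  refine forall_congr' fun i => ⟨?_, fun h => ⟨l, a i, hp l, hp (a i), h⟩⟩
  rintro ⟨l', a', hl, ha, h⟩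
  rwa [(hp l).eq hl, (hp (a i)).eq ha]

variable {R : Type y} [CommRing R] [LieAlgebra R L]

/-- `A` need not be definable: a finite subset of `A` imposes the same conditions. -/
theorem InterpretsLieRing.definableSubset_relCentralizer (hM : 𝓛.IsStableStructure M)
    (hc : c.InterpretsLieRing 𝓛) (K B : LieSubalgebra R L)
    (hB : ∀ y ∈ K, ∀ b ∈ B, ⁅y, b⁆ ∈ B) (A : Set L) (hKd : c.DefinableSubset 𝓛 (K : Set L))
    (hBd : c.DefinableSubset 𝓛 (B : Set L)) :
    c.DefinableSubset 𝓛 (K.relCentralizer B hB A : Set L) := by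
  let C : L → AddSubgroup L := fun a =>
    { carrier := {l | ⁅l, a⁆ ∈ B}
      zero_mem' := by simp
      add_mem' := fun {l l'} hl hl' => by
        simpa only [Set.mem_ofPred_eq, add_lie] using B.add_mem hl hl'
      neg_mem' := fun {l} hl => by
        rw [Set.mem_ofPred_eq, neg_lie]
        exact B.neg_mem hl }
  obtain ⟨s, hs, h⟩ := exists_finset_forall_mem_of_orderBounded C
    (fun n => hc.orderBounded_lie_mem hM hBd n) A
  convert hKd.inter (DefinableSubset.biInter_finset hc.domain s (fun a => {l | ⁅l, a⁆ ∈ B})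
    fun a _ => definableSubset_fiber (hc.definable_lie_mem hBd) a) using 1
  ext l
  exact and_congr_right fun _ => ⟨fun hl a ha => hl a (hs ha), fun hl => h l hl⟩

end Coordinatization

/-- Lie rings are the case `R = ℤ`, Lie algebras over a field the case where `R` is a field.
The structure `M` may be `L` itself, in any language (the coordinatization is then the identity),
or for instance the two-sorted structure made of `L` and its field of scalars. -/
theorem mainTheorem9
    {𝓛 : FirstOrder.Language.{u, v}} {M : Type w} [𝓛.Structure M] (hM : 𝓛.IsStableStructure M)
    {R : Type y} {L : Type x} [CommRing R] [LieRing L] [LieAlgebra R L]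
    (c : Coordinatization M L) (hc : c.InterpretsLieRing 𝓛) (N : LieIdeal R L) :
    (LieRing.IsNilpotent N →
      ∃ H : LieSubalgebra R L, (N : Set L) ⊆ (H : Set L) ∧ H.IsSubideal ∧
        c.DefinableSubset 𝓛 (H : Set L) ∧ LieRing.IsNilpotent H) ∧
    (LieAlgebra.IsSolvable N →
      ∃ H : LieSubalgebra R L, (N : Set L) ⊆ (H : Set L) ∧ H.IsSubideal ∧
        c.DefinableSubset 𝓛 (H : Set L) ∧ LieAlgebra.IsSolvable H) :=
  ⟨LieSubalgebra.exists_nilpotent_subideal _ hc.definableSubset_zero hc.domain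
    (hc.definableSubset_relCentralizer hM) N,
  LieSubalgebra.exists_solvable_subideal _ hc.definableSubset_zero hc.domain
    (hc.definableSubset_relCentralizer hM) N⟩
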